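/- For integers $p\ge 0$, $k\ge -1$ and $n\ge 1$, let $\mathcal S_{p,k,n}\subset L^2(0,1)$ be the (finite-dimensional) space of real splines of degree $p$ and smoothness $k$ on $n$ uniform segments, that is, of functions $f\in C^k([0,1])$ (no condition if $k=-1$) whose restriction to each interval $[\frac jn,\frac{j+1}n)$, $j=0,\dots,n-1$, is a polynomial of degree at most $p$. Let $\Pi_{p,k,n}$ be the $L^2(0,1)$-orthogonal projection onto $\mathcal S_{p,k,n}$, and let $C_{p,k,n}$ be the smallest real number such that $$\|f-\Pi_{p,k,n}f\|_{L^2(0,1)}\le C_{p,k,n}\,\|\partial^{p+1}f\|_{L^2(0,1)}\qquad\text{for all } f\in H^{p+1}(0,1).$$ **Theorem.** For all integers $k\ge -1$ and $n\ge 2$ there exists an integer $\bar p>k$ such that for all integers $p\ge\bar p$, with $m=(n-1)(p-k)+1$, the smallest constants $C_{p,p-1,m}$ and $C_{p,k,n}$ exist and $$C_{p,p-1,m}<C_{p,k,n}.$$ -/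

import Mathlib

open MeasureTheory Set
open scoped ContDiff Polynomial

noncomputable section

namespace SplineApprox

/-- The Hilbert space `L²(0,1)` of real-valued functions. -/
abbrev L2 : Type := Lp ℝ 2 (volume.restrict (Ioo (0 : ℝ) 1))

/-- `g ∈ L²(0,1)` is the weak derivative of order `j` of `f ∈ L²(0,1)`:
`∫ f φ⁽ʲ⁾ = (-1)ʲ ∫ g φ` over `(0,1)` for every test function `φ ∈ C_c^∞(0,1)`. -/
def HasWeakDeriv (j : ℕ) (f g : L2) : Prop :=
  ∀ φ : ℝ → ℝ, ContDiff ℝ ∞ φ → HasCompactSupport φ → tsupport φ ⊆ Ioo 0 1 →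
    ∫ x in Ioo (0 : ℝ) 1, f x * iteratedDeriv j φ x =
      (-1) ^ j * ∫ x in Ioo (0 : ℝ) 1, g x * φ x

/-- The Sobolev space `H^r(0,1)`: the functions in `L²(0,1)` all of whose weak derivatives
up to order `r` exist and belong to `L²(0,1)`. -/
def sobolev (r : ℕ) : Set L2 :=
  {f | ∀ j ≤ r, ∃ g : L2, HasWeakDeriv j f g}

/-- The `j`-th mesh interval `[j/n, (j+1)/n)` of the uniform partition of `[0,1]` in `n`
segments. -/
def segment (n : ℕ+) (j : Fin n) : Set ℝ :=
  Ico ((j : ℝ) / (n : ℝ)) (((j : ℝ) + 1) / (n : ℝ))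

/-- `s` is a spline of degree `p` and smoothness `k` on `n` uniform segments: it is of class `C^k`
on `[0,1]` (no condition if `k = -1`) and on each mesh interval it is a polynomial of degree at
most `p`. -/
def IsSpline (p : ℕ) (k : ℤ) (n : ℕ+) (s : ℝ → ℝ) : Prop :=
  (0 ≤ k → ContDiffOn ℝ (k.toNat : ℕ∞ω) s (Icc 0 1)) ∧
    ∀ j : Fin n, ∃ P : ℝ[X], P.natDegree ≤ p ∧ ∀ x ∈ segment n j, s x = P.eval x

/-- The space of splines of degree `p` and smoothness `k` on `n` uniform segments, as a subspace
of `L²(0,1)`. -/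
def splineSpace (p : ℕ) (k : ℤ) (n : ℕ+) : Submodule ℝ L2 where
  carrier := {f | ∃ s : ℝ → ℝ, IsSpline p k n s ∧ f =ᵐ[volume.restrict (Ioo (0 : ℝ) 1)] s}
  zero_mem' := ⟨0, ⟨fun _ => contDiffOn_const, fun _ => ⟨0, by simp, by simp⟩⟩, Lp.coeFn_zero _ _ _⟩
  add_mem' := by
    rintro f g ⟨s, ⟨hs, hs'⟩, hfs⟩ ⟨t, ⟨ht, ht'⟩, hgt⟩
    refine ⟨s + t, ⟨fun hk => (hs hk).add (ht hk), fun j => ?_⟩,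
      (Lp.coeFn_add f g).trans (hfs.add hgt)⟩
    obtain ⟨P, hP, hPs⟩ := hs' j
    obtain ⟨Q, hQ, hQt⟩ := ht' j
    exact ⟨P + Q, Polynomial.natDegree_add_le_of_degree_le hP hQ, fun x hx => by
      simp [hPs x hx, hQt x hx]⟩
  smul_mem' := by
    rintro c f ⟨s, ⟨hs, hs'⟩, hfs⟩
    refine ⟨c • s, ⟨fun hk => (hs hk).const_smul c, fun j => ?_⟩,
      (Lp.coeFn_smul c f).trans (hfs.const_smul c)⟩
    obtain ⟨P, hP, hPs⟩ := hs' j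
    exact ⟨c • P, (Polynomial.natDegree_smul_le c P).trans hP, fun x hx => by
      simp [hPs x hx]⟩

theorem memLp_piecewise (n : ℕ+) (c : Fin n → ℝ[X]) :
    MemLp (fun x => ∑ j, (segment n j).indicator (fun y => (c j).eval y) x) 2
      (volume.restrict (Ioo (0 : ℝ) 1)) := by
  refine memLp_finsetSum _ fun j _ => MemLp.indicator measurableSet_Ico ?_
  obtain ⟨M, hM⟩ := isCompact_Icc.exists_bound_of_continuousOn
    ((c j).continuous.continuousOn (s := Icc (0 : ℝ) 1))
  refine MemLp.of_bound (c j).continuous.aestronglyMeasurable M ?_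
  filter_upwards [ae_restrict_mem measurableSet_Ioo] with x hx
  exact hM x (Ioo_subset_Icc_self hx)

/-- The map that sends polynomials `(c j)` to the piecewise polynomial function in `L²(0,1)`. -/
def piecewisePoly (p : ℕ) (n : ℕ+) : (Fin n → Polynomial.degreeLE ℝ p) →ₗ[ℝ] L2 where
  toFun c := (memLp_piecewise n fun j => (c j : ℝ[X])).toLp _
  map_add' c d := by
    rw [← MemLp.toLp_add]
    refine MemLp.toLp_congr _ _ (Filter.Eventually.of_forall fun x => ?_)
    simp only [Pi.add_apply, Submodule.coe_add, Polynomial.eval_add, ← Finset.sum_add_distrib]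
    refine Finset.sum_congr rfl fun j _ => ?_
    by_cases hx : x ∈ segment n j <;> simp [hx]
  map_smul' a c := by
    rw [RingHom.id_apply, ← MemLp.toLp_const_smul]
    refine MemLp.toLp_congr _ _ (Filter.Eventually.of_forall fun x => ?_)
    simp only [Pi.smul_apply, Submodule.coe_smul, Polynomial.eval_smul, Finset.smul_sum]
    refine Finset.sum_congr rfl fun j _ => ?_
    by_cases hx : x ∈ segment n j <;> simp [hx]

theorem exists_mem_segment (n : ℕ+) {x : ℝ} (hx : x ∈ Ioo (0 : ℝ) 1) :
    ∃ j : Fin n, x ∈ segment n j := by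
  have hn : (0 : ℝ) < (n : ℝ) := by exact_mod_cast n.pos
  have h0 : 0 ≤ x * n := mul_nonneg hx.1.le hn.le
  refine ⟨⟨⌊x * n⌋₊, (Nat.floor_lt h0).2 (by nlinarith [hx.2])⟩, ?_, ?_⟩
  · exact (div_le_iff₀ hn).2 (Nat.floor_le h0)
  · exact (lt_div_iff₀ hn).2 (Nat.lt_floor_add_one _)

theorem segment_unique (n : ℕ+) {x : ℝ} {i j : Fin n} (hi : x ∈ segment n i)
    (hj : x ∈ segment n j) : i = j := by
  have hn : (0 : ℝ) < (n : ℝ) := by exact_mod_cast n.pos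
  have h1 := (div_le_iff₀ hn).1 hi.1
  have h2 := (lt_div_iff₀ hn).1 hi.2
  have h3 := (div_le_iff₀ hn).1 hj.1
  have h4 := (lt_div_iff₀ hn).1 hj.2
  have h5 : (i : ℕ) < (j : ℕ) + 1 := by exact_mod_cast h1.trans_lt h4
  have h6 : (j : ℕ) < (i : ℕ) + 1 := by exact_mod_cast h3.trans_lt h2
  exact Fin.ext (by omega)

theorem splineSpace_le_range (p : ℕ) (k : ℤ) (n : ℕ+) :
    splineSpace p k n ≤ LinearMap.range (piecewisePoly p n) := by
  rintro f ⟨s, ⟨-, hs⟩, hfs⟩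
  choose P hP hPs using hs
  refine ⟨fun j => ⟨P j, Polynomial.mem_degreeLE.2
    (Polynomial.natDegree_le_iff_degree_le.1 (hP j))⟩, ?_⟩
  refine Lp.ext ((MemLp.coeFn_toLp (memLp_piecewise n P)).trans ?_)
  refine Filter.EventuallyEq.trans ?_ hfs.symm
  filter_upwards [ae_restrict_mem measurableSet_Ioo] with x hx
  obtain ⟨j, hj⟩ := exists_mem_segment n hx
  rw [Finset.sum_eq_single j]
  · simp [hj, hPs j x hj]
  · intro i _ hij
    exact indicator_of_notMem (fun hi => hij (segment_unique n hi hj)) _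
  · simp

instance finiteDimensional_splineSpace (p : ℕ) (k : ℤ) (n : ℕ+) :
    FiniteDimensional ℝ (splineSpace p k n) := by
  have : FiniteDimensional ℝ (Polynomial.degreeLE ℝ p) := by
    rw [Polynomial.degreeLE_eq_span_X_pow]
    exact FiniteDimensional.span_finset ℝ _
  exact Submodule.finiteDimensional_of_le (splineSpace_le_range p k n)

/-- The `L²(0,1)`-orthogonal projection onto the spline space. -/
def splineProj (p : ℕ) (k : ℤ) (n : ℕ+) : L2 →L[ℝ] L2 :=
  (splineSpace p k n).starProjection

/-- The set of real `C` such that `‖f - Π f‖ ≤ C ‖∂^{q+1} f‖` for all `f ∈ H^{q+1}(0,1)`, where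
`Π` is the orthogonal projection onto the spline space. -/
def admissibleConstants (p : ℕ) (k : ℤ) (n : ℕ+) (q : ℕ) : Set ℝ :=
  {C | ∀ f ∈ sobolev (q + 1), ∀ g : L2, HasWeakDeriv (q + 1) f g →
    ‖f - splineProj p k n f‖ ≤ C * ‖g‖}

/-- The best constant `C_{p,k,n,q}`, the smallest element of `admissibleConstants p k n q`. -/
def bestConst (p : ℕ) (k : ℤ) (n : ℕ+) (q : ℕ) : ℝ :=
  sInf (admissibleConstants p k n q)

/-- The best constant `C_{p,k,n} = C_{p,k,n,p}`. -/
def splineConst (p : ℕ) (k : ℤ) (n : ℕ+) : ℝ := bestConst p k n p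

end SplineApprox

end

/-!
The two best constants are separated by explicit bounds. For maximally smooth splines on `m`
segments, `C_{p,p-1,m} ≤ (1 / (3 m)) ^ (p + 1)`; for every smoothness `k` on `n` segments,
`C_{p,k,n} ^ 2 ≥ (1 / n) ^ (2 (p + 1)) * legendreConst (p + 1)`.

*Upper bound.* By the du Bois-Reymond lemma (`HasWeakDeriv.exists_polynomial`) a function with weak
derivative `g` of order `p + 1` is, up to a polynomial of degree at most `p`, the `(p + 1)`-fold
primitive of `g`; the polynomial is itself a spline. So only iterates of the Volterra operator `V`
matter. Piecewise constants approximate `V u` with error `‖u‖ / (3 m)`, by the Poincaré inequality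
on each segment. A duality argument (`norm_sub_starProjection_map_le`), which uses only
`⟪V d, e⟫ + ⟪d, V e⟫ = ⟪d, 1⟫ ⟪e, 1⟫` and the fact that `V` maps splines of degree `q` to splines
of degree `q + 1`, transports this bound to every degree and gains one factor `1 / (3 m)` for each
integration. The sharp constant in place of `3` is `π`, but `3` suffices and makes the weight in
Wirtinger's inequality nonsingular.

*Lower bound.* On a segment of length `1 / n`, the function `x ^ (p + 1) / (p + 1)!` minus a
polynomial of degree at most `p` has an `L²` norm bounded below by that of a multiple of the
Legendre polynomial (`le_integral_eval_sq_of_interval`), which the Rodrigues formula computes.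

*Comparison.* With `N = p + 1`, `d = k + 1` and `m > (n - 1) (N - d)`, and since
`n / (n - 1) ≤ 2`, it remains to see that `(2 / (3 (N - d))) ^ (2 N) < legendreConst N` for large
`N`. By Stirling's formula the `2 N`-th root of `legendreConst N` is asymptotic to `e / (4 N)`, and
`2 / 3 < e / 4` (`eventually_pow_lt_legendreConst`).
-/

noncomputable section

namespace SplineApprox

/-! ### Integration by parts and the Poincaré inequality on an interval -/

/-- Integration by parts for the primitives of two integrable functions. -/
theorem integral_primitive_mul_add {u v : ℝ → ℝ} {a b : ℝ}
    (hu : IntervalIntegrable u volume a b) (hv : IntervalIntegrable v volume a b) :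
    (∫ x in a..b, (∫ t in a..x, u t) * v x) + ∫ x in a..b, u x * ∫ t in a..x, v t =
      (∫ t in a..b, u t) * ∫ t in a..b, v t := by
  have hU := hu.absolutelyContinuousOnInterval_intervalIntegral (c := a) (by simp)
  have hV := hv.absolutelyContinuousOnInterval_intervalIntegral (c := a) (by simp)
  have h := hU.integral_deriv_mul_eq_sub hV
  simp only [intervalIntegral.integral_same, zero_mul, sub_zero] at h
  rw [← h, add_comm, ← intervalIntegral.integral_add]
  · refine intervalIntegral.integral_congr_ae ?_
    filter_upwards [hu.ae_hasDerivAt_integral, hv.ae_hasDerivAt_integral] with x h1 h2 hx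
    have hx' : x ∈ uIcc a b := uIoc_subset_uIcc hx
    rw [(h1 hx' a (by simp)).deriv, (h2 hx' a (by simp)).deriv]
  · exact hu.mul_continuousOn hV.continuousOn
  · exact hv.continuousOn_mul hU.continuousOn

/-- Wirtinger's inequality with the constant `3` in place of the sharp `π`. Completing the square
with `α tan (α (x - c))`, where `c` is the midpoint and `α = 3 / (b - a)`, is legitimate on the
closed interval because `3 < π`. -/
theorem wirtinger_le {w e : ℝ → ℝ} {a b : ℝ} (hab : a < b)
    (hw : ContinuousOn w (Icc a b)) (he : ContinuousOn e (Icc a b))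
    (hwe : ∀ x ∈ Ioo a b, HasDerivAt w (e x) x) (ha : w a = 0) (hb : w b = 0) :
    ∫ x in a..b, w x ^ 2 ≤ ((b - a) / 3) ^ 2 * ∫ x in a..b, e x ^ 2 := by
  have hL : 0 < b - a := sub_pos.2 hab
  set α : ℝ := 3 / (b - a) with hα
  set c : ℝ := (a + b) / 2 with hc
  have hαL : α * (b - a) = 3 := by rw [hα]; field_simp
  have hα0 : 0 < α := by positivity
  have hcos : ∀ x ∈ Icc a b, Real.cos (α * (x - c)) ≠ 0 := by
    intro x hx
    have hπ := Real.pi_gt_three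
    refine (Real.cos_pos_of_mem_Ioo ⟨?_, ?_⟩).ne'
    · nlinarith [mul_le_mul_of_nonneg_left hx.1 hα0.le]
    · nlinarith [mul_le_mul_of_nonneg_left hx.2 hα0.le]
  set T : ℝ → ℝ := fun x => Real.tan (α * (x - c)) with hT
  have hTc : ContinuousOn T (Icc a b) := by
    intro x hx
    refine ContinuousAt.continuousWithinAt ?_
    exact ContinuousAt.comp (f := fun x => α * (x - c)) (Real.continuousAt_tan.2 (hcos x hx))
      (by fun_prop)
  have hTd : ∀ x ∈ Icc a b, HasDerivAt T (α * (1 + T x ^ 2)) x := by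
    intro x hx
    have h1 : HasDerivAt (fun x => α * (x - c)) α x := by
      simpa using ((hasDerivAt_id x).sub_const c).const_mul α
    have h2 := (Real.hasDerivAt_tan (hcos x hx)).comp x h1
    refine h2.congr_deriv ?_
    rw [← Real.inv_one_add_tan_sq (hcos x hx)]
    simp only [hT]
    have : (1 + Real.tan (α * (x - c)) ^ 2) ≠ 0 := by positivity
    field_simp
  -- `G'` is the derivative of `α * T * w ^ 2`, which vanishes at both ends.
  set G' : ℝ → ℝ := fun x => α * (α * (1 + T x ^ 2)) * w x ^ 2 + α * T x * (2 * w x * e x)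
  have hG'c : ContinuousOn G' (Icc a b) := by fun_prop
  have hI : ∀ {f : ℝ → ℝ}, ContinuousOn f (Icc a b) → IntervalIntegrable f volume a b :=
    fun hf => (hf.mono (by rw [uIcc_of_le hab.le])).intervalIntegrable
  have hG : ∫ x in a..b, G' x = 0 := by
    rw [intervalIntegral.integral_eq_sub_of_hasDerivAt_of_le hab.le
      (f := fun x => α * T x * w x ^ 2) (by fun_prop) _ (hI hG'c)]
    · simp [ha, hb]
    · intro x hx
      refine (((hTd x (Ioo_subset_Icc_self hx)).const_mul α).mul ((hwe x hx).pow 2)).congr_deriv ?_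
      simp [G']
  have hsq : 0 ≤ ∫ x in a..b, (e x ^ 2 + G' x - α ^ 2 * w x ^ 2) := by
    refine intervalIntegral.integral_nonneg hab.le fun x hx => ?_
    have : e x ^ 2 + G' x - α ^ 2 * w x ^ 2 = (e x + α * T x * w x) ^ 2 := by
      simp only [G']; ring
    rw [this]; positivity
  rw [intervalIntegral.integral_sub (hI (by fun_prop)) (hI (by fun_prop)),
    intervalIntegral.integral_add (hI (by fun_prop)) (hI hG'c), hG,
    intervalIntegral.integral_const_mul] at hsq
  have h3 : ((b - a) / 3) ^ 2 * α ^ 2 = 1 := by rw [hα]; field_simp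
  have := mul_le_mul_of_nonneg_left (sub_nonneg.1 hsq) (sq_nonneg ((b - a) / 3))
  rw [← mul_assoc, h3] at this
  linarith

/-- The Poincaré inequality for functions with an `L²` derivative. The zero-mean error is the
derivative of a function that vanishes at both ends, so it follows by duality from
`wirtinger_le`. -/
theorem exists_integral_primitive_sub_sq_le {u : ℝ → ℝ} {a b : ℝ} (hab : a < b)
    (hu : IntervalIntegrable u volume a b)
    (hu2 : IntervalIntegrable (fun x => u x ^ 2) volume a b) :
    ∃ c : ℝ, ∫ x in a..b, ((∫ t in a..x, u t) - c) ^ 2 ≤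
      ((b - a) / 3) ^ 2 * ∫ x in a..b, u x ^ 2 := by
  have hL : 0 < b - a := sub_pos.2 hab
  have hUc : ContinuousOn (fun x => ∫ t in a..x, u t) (Icc a b) := by
    rw [← uIcc_of_le hab.le]
    exact (hu.absolutelyContinuousOnInterval_intervalIntegral (c := a) (by simp)).continuousOn
  have hI : ∀ {f : ℝ → ℝ}, ContinuousOn f (Icc a b) → IntervalIntegrable f volume a b :=
    fun hf => (hf.mono (by rw [uIcc_of_le hab.le])).intervalIntegrable
  set c : ℝ := (∫ x in a..b, ∫ t in a..x, u t) / (b - a) with hc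
  set e : ℝ → ℝ := fun x => (∫ t in a..x, u t) - c with he
  have hec : ContinuousOn e (Icc a b) := hUc.sub continuousOn_const
  have he0 : ∫ x in a..b, e x = 0 := by
    rw [he, intervalIntegral.integral_sub (hI hUc) (hI continuousOn_const),
      intervalIntegral.integral_const, hc, smul_eq_mul]
    field_simp
    ring
  set w : ℝ → ℝ := fun x => ∫ t in a..x, e t with hw
  have hwc : ContinuousOn w (Icc a b) := by
    rw [← uIcc_of_le hab.le]
    exact ((hI hec).absolutelyContinuousOnInterval_intervalIntegral (c := a) (by simp)).continuousOn
  have hwd : ∀ x ∈ Ioo a b, HasDerivAt w (e x) x := by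
    intro x hx
    refine intervalIntegral.integral_hasDerivAt_right ?_ ?_
      (hec.continuousAt (Icc_mem_nhds hx.1 hx.2))
    · exact (hI hec).mono_set (by rw [uIcc_of_le hab.le, uIcc_of_le hx.1.le]
                                  exact Icc_subset_Icc_right hx.2.le)
    · exact (hec.mono Ioo_subset_Icc_self).stronglyMeasurableAtFilter isOpen_Ioo x hx
  have hW := wirtinger_le hab hwc hec hwd (by simp [hw]) he0
  have hibp := integral_primitive_mul_add hu (hI hec)
  have h1 : ∫ x in a..b, e x ^ 2 = -∫ x in a..b, u x * w x := by
    have hUe : ContinuousOn (fun x => (∫ t in a..x, u t) * e x) (Icc a b) := hUc.mul hec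
    have : ∫ x in a..b, e x ^ 2 =
        (∫ x in a..b, (∫ t in a..x, u t) * e x) - c * ∫ x in a..b, e x := by
      rw [← intervalIntegral.integral_const_mul,
        ← intervalIntegral.integral_sub (hI hUe) (hI (hec.const_mul c))]
      exact intervalIntegral.integral_congr fun x _ => by simp only [he]; ring
    rw [this, he0]
    rw [he0, mul_zero] at hibp
    linarith
  refine ⟨c, ?_⟩
  change ∫ x in a..b, e x ^ 2 ≤ _
  set t : ℝ := ((b - a) / 3) ^ 2 with ht
  have ht0 : 0 < t := by positivity
  have huw : IntervalIntegrable (fun x => u x * w x) volume a b :=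
    hu.mul_continuousOn (by rwa [uIcc_of_le hab.le])
  have hw2 : IntervalIntegrable (fun x => w x ^ 2) volume a b := hI (hwc.pow 2)
  -- Young's inequality with the weight `t`, so that `wirtinger_le` absorbs the term in `w`.
  have h2 : 0 ≤ ∫ x in a..b, (t * u x ^ 2 + t⁻¹ * w x ^ 2 + 2 * (u x * w x)) := by
    refine intervalIntegral.integral_nonneg hab.le fun x _ => ?_
    have : t * u x ^ 2 + t⁻¹ * w x ^ 2 + 2 * (u x * w x) = t⁻¹ * (t * u x + w x) ^ 2 := by
      field_simp
      ring
    rw [this]; positivity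
  rw [intervalIntegral.integral_add ((hu2.const_mul t).add (hw2.const_mul _)) (huw.const_mul 2),
    intervalIntegral.integral_add (hu2.const_mul t) (hw2.const_mul _),
    intervalIntegral.integral_const_mul, intervalIntegral.integral_const_mul,
    intervalIntegral.integral_const_mul] at h2
  have h3 : t⁻¹ * ∫ x in a..b, w x ^ 2 ≤ ∫ x in a..b, e x ^ 2 := by
    rw [inv_mul_le_iff₀ ht0]; exact hW
  linarith

/-! ### Approximation of iterated integrals in a Hilbert space -/

section Hilbert
variable {H : Type*} [NormedAddCommGroup H] [InnerProductSpace ℝ H]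

theorem norm_sub_starProjection_le (S : Submodule ℝ H) [S.HasOrthogonalProjection] (y : H)
    {s : H} (hs : s ∈ S) : ‖y - S.starProjection y‖ ≤ ‖y - s‖ := by
  rw [Submodule.starProjection_minimal]
  exact ciInf_le ⟨0, by rintro _ ⟨x, rfl⟩; positivity⟩ (⟨s, hs⟩ : S)

/-- A duality argument of Aubin-Nitsche type. The operator `V` stands for integration, the unit
vector `o` for the constant function `1`, and `hV` for integration by parts. -/
theorem norm_sub_starProjection_map_le (V : H →ₗ[ℝ] H) {o : H} (ho : ‖o‖ = 1)
    (hV : ∀ d e : H, inner ℝ (V d) e + inner ℝ d (V e) = inner ℝ d o * inner ℝ e o)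
    (S T : Submodule ℝ H) [S.HasOrthogonalProjection] [T.HasOrthogonalProjection]
    (hoT : o ∈ T) (hST : ∀ s ∈ S, V s ∈ T) {C : ℝ} (hC : 0 ≤ C)
    (h : ∀ u, ‖V u - S.starProjection (V u)‖ ≤ C * ‖u‖) (u : H) :
    ‖V u - T.starProjection (V u)‖ ≤ C * ‖u - S.starProjection u‖ := by
  set d : H := u - S.starProjection u with hd
  -- The error of a particular element of `T`, corrected by a constant so that `e ⟂ o`.
  set e : H := V d - inner ℝ (V d) o • o with he
  have hle : ‖V u - T.starProjection (V u)‖ ≤ ‖e‖ := by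
    have hmem : V (S.starProjection u) + inner ℝ (V d) o • o ∈ T :=
      T.add_mem (hST _ (S.starProjection_apply_mem u)) (T.smul_mem _ hoT)
    refine (norm_sub_starProjection_le T _ hmem).trans_eq ?_
    rw [he, hd, map_sub]
    congr 1
    abel
  refine hle.trans ?_
  have hoo : inner ℝ o o = 1 := by rw [real_inner_self_eq_norm_sq, ho, one_pow]
  have heo : inner ℝ e o = 0 := by
    rw [he, inner_sub_left, inner_smul_left, hoo]; simp
  have hee : ‖e‖ ^ 2 = -inner ℝ d (V e - S.starProjection (V e)) := by
    have h1 : inner ℝ d (S.starProjection (V e)) = 0 :=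
      S.starProjection_inner_eq_zero u _ (S.starProjection_apply_mem _)
    have h2 := hV d e
    rw [heo, mul_zero] at h2
    rw [inner_sub_right, h1, sub_zero, ← real_inner_self_eq_norm_sq]
    have h3 : inner ℝ e e = inner ℝ (V d) e - inner ℝ (V d) o * inner ℝ o e := by
      conv_lhs => rw [he, inner_sub_left, inner_smul_left, ← he]
      simp
    rw [h3, real_inner_comm e o, heo]
    linarith
  have h3 : ‖e‖ * ‖e‖ ≤ (C * ‖d‖) * ‖e‖ := by
    calc ‖e‖ * ‖e‖ = ‖e‖ ^ 2 := (sq _).symm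
      _ ≤ ‖d‖ * ‖V e - S.starProjection (V e)‖ := by
        rw [hee]; exact (neg_le_abs _).trans (abs_real_inner_le_norm _ _)
      _ ≤ ‖d‖ * (C * ‖e‖) := by gcongr; exact h e
      _ = _ := by ring
  rcases (norm_nonneg e).eq_or_lt with h0 | h0
  · rw [← h0]; positivity
  · exact le_of_mul_le_mul_right h3 h0

/-- If `V` maps each space of the sequence `S` into the next one, an error bound for `S 0` and
one integration carries over to `S q` and `q + 1` integrations. -/
theorem norm_sub_starProjection_iterate_le (V : H →ₗ[ℝ] H) {o : H} (ho : ‖o‖ = 1)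
    (hV : ∀ d e : H, inner ℝ (V d) e + inner ℝ d (V e) = inner ℝ d o * inner ℝ e o)
    (S : ℕ → Submodule ℝ H) [∀ q, (S q).HasOrthogonalProjection]
    (hoS : ∀ q, o ∈ S q) (hS : ∀ q, ∀ s ∈ S q, V s ∈ S (q + 1)) {C : ℝ} (hC : 0 ≤ C)
    (h0 : ∀ u, ‖V u - (S 0).starProjection (V u)‖ ≤ C * ‖u‖) (q : ℕ) (g : H) :
    ‖V^[q + 1] g - (S q).starProjection (V^[q + 1] g)‖ ≤ C ^ (q + 1) * ‖g‖ := by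
  have h1 : ∀ q u, ‖V u - (S q).starProjection (V u)‖ ≤ C * ‖u‖ := by
    intro q
    induction q with
    | zero => exact h0
    | succ q ih =>
      intro u
      refine (norm_sub_starProjection_map_le V ho hV (S q) (S (q + 1)) (hoS _) (hS q) hC ih
        u).trans ?_
      have := norm_sub_starProjection_le (S q) u (S q).zero_mem
      rw [sub_zero] at this
      gcongr
  induction q with
  | zero => simpa using h0 g
  | succ q ih =>
    rw [Function.iterate_succ_apply']
    refine (norm_sub_starProjection_map_le V ho hV (S q) (S (q + 1)) (hoS _) (hS q) hC (h1 q)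
      _).trans ?_
    calc _ ≤ C * (C ^ (q + 1) * ‖g‖) := by gcongr
      _ = _ := by ring

end Hilbert

/-! ### Polynomials of small `L²` norm with prescribed leading coefficient -/

open Polynomial in
theorem integral_eval_mul_derivative (P Q : ℝ[X]) (a b : ℝ) :
    ∫ x in a..b, P.eval x * (derivative Q).eval x =
      P.eval b * Q.eval b - P.eval a * Q.eval a -
        ∫ x in a..b, (derivative P).eval x * Q.eval x :=
  intervalIntegral.integral_mul_deriv_eq_deriv_mul (fun x _ => P.hasDerivAt x)
    (fun x _ => Q.hasDerivAt x) ((derivative P).continuous.intervalIntegrable _ _)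
    ((derivative Q).continuous.intervalIntegrable _ _)

theorem integral_pow_mul_one_sub_pow (a b : ℕ) :
    ∫ x in (0 : ℝ)..1, x ^ a * (1 - x) ^ b =
      a.factorial * b.factorial / (a + b + 1).factorial := by
  induction b generalizing a with
  | zero =>
    simp only [pow_zero, mul_one, integral_pow, one_pow, Nat.factorial]
    push_cast
    have := Nat.factorial_ne_zero a
    field_simp
    simp
  | succ b ih =>
    have h := integral_eval_mul_derivative ((1 - Polynomial.X) ^ (b + 1))
      (Polynomial.X ^ (a + 1)) 0 1
    simp only [Polynomial.derivative_pow, Polynomial.eval_mul, Polynomial.eval_pow,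
      Polynomial.eval_sub, Polynomial.eval_one, Polynomial.eval_X, Polynomial.derivative_X,
      Polynomial.derivative_sub, Polynomial.derivative_one,
      Polynomial.eval_C, Nat.add_sub_cancel, Polynomial.eval_zero] at h
    have e1 : ∫ x in (0 : ℝ)..1, (1 - x) ^ (b + 1) * (((a + 1 : ℕ) : ℝ) * x ^ a * 1) =
        (a + 1) * ∫ x in (0 : ℝ)..1, x ^ a * (1 - x) ^ (b + 1) := by
      rw [← intervalIntegral.integral_const_mul]
      congr 1; ext x; push_cast; ring
    have e2 : ∫ x in (0 : ℝ)..1, ((b + 1 : ℕ) : ℝ) * (1 - x) ^ b * (0 - 1) * x ^ (a + 1) =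
        -((b + 1) * ∫ x in (0 : ℝ)..1, x ^ (a + 1) * (1 - x) ^ b) := by
      rw [← intervalIntegral.integral_const_mul, ← intervalIntegral.integral_neg]
      congr 1; ext x; push_cast; ring
    rw [e1, e2, ih] at h
    have h' : ((a : ℝ) + 1) * ∫ x in (0 : ℝ)..1, x ^ a * (1 - x) ^ (b + 1) =
        (b + 1) * ((a + 1).factorial * b.factorial / (a + 1 + b + 1).factorial) := by
      rw [h]; simp
    have ha : (a : ℝ) + 1 ≠ 0 := by positivity
    rw [← mul_right_inj' ha, h', show a + (b + 1) + 1 = a + 1 + b + 1 by ring,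
      Nat.factorial_succ a, Nat.factorial_succ b]
    push_cast
    ring

/-- The polynomial `X ^ N * (1 - X) ^ N`; its `N`-th derivative is, up to normalisation, the
Legendre polynomial of degree `N` on `[0,1]`. -/
def rodrigues (N : ℕ) : ℝ[X] := (Polynomial.X * (1 - Polynomial.X)) ^ N

open Polynomial in
theorem eval_iterate_derivative_rodrigues {N i : ℕ} (hi : i < N) {x : ℝ} (hx : x * (1 - x) = 0) :
    (derivative^[i] (rodrigues N)).eval x = 0 := by
  obtain ⟨Q, hQ⟩ := pow_sub_dvd_iterate_derivative_pow (X * (1 - X) : ℝ[X]) N i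
  rw [rodrigues, hQ, eval_mul, eval_pow]
  simp [hx, Nat.sub_ne_zero_of_lt hi]

open Polynomial in
theorem integral_eval_mul_iterate_derivative_rodrigues (N : ℕ) (Q : ℝ[X]) {i : ℕ} (hi : i ≤ N) :
    ∫ x in (0 : ℝ)..1, Q.eval x * (derivative^[i] (rodrigues N)).eval x =
      (-1) ^ i * ∫ x in (0 : ℝ)..1, (derivative^[i] Q).eval x * (rodrigues N).eval x := by
  induction i generalizing Q with
  | zero => simp
  | succ i ih =>
    rw [Function.iterate_succ_apply', integral_eval_mul_derivative,
      eval_iterate_derivative_rodrigues (by omega) (by simp),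
      eval_iterate_derivative_rodrigues (by omega) (by simp), ih _ (by omega),
      Function.iterate_succ_apply]
    ring

open Polynomial in
/-- Only the leading coefficient of `Q` contributes, by orthogonality of the Legendre
polynomial to lower degrees. -/
theorem integral_eval_mul_legendre {N : ℕ} {Q : ℝ[X]} (hQ : Q.natDegree ≤ N) :
    ∫ x in (0 : ℝ)..1, Q.eval x * (derivative^[N] (rodrigues N)).eval x =
      (-1) ^ N *
        (Q.coeff N * N.factorial * (N.factorial * N.factorial / (2 * N + 1).factorial)) := by
  have hD : derivative^[N] Q = C (Q.coeff N * N.factorial) := by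
    have hdeg : (derivative^[N] Q).natDegree ≤ 0 := by
      have := natDegree_iterate_derivative Q N
      omega
    rw [eq_C_of_natDegree_le_zero hdeg, coeff_iterate_derivative]
    simp [Nat.descFactorial_self, mul_comm]
  rw [integral_eval_mul_iterate_derivative_rodrigues N Q le_rfl, hD]
  have h := integral_pow_mul_one_sub_pow N N
  rw [show N + N + 1 = 2 * N + 1 by ring] at h
  rw [← h, ← intervalIntegral.integral_const_mul (Q.coeff N * N.factorial)]
  congr 2
  ext x
  simp [rodrigues, mul_pow]

open Polynomial in
theorem natDegree_rodrigues_le (N : ℕ) : (rodrigues N).natDegree ≤ 2 * N := by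
  have h : (X * (1 - X) : ℝ[X]).natDegree ≤ 2 := by compute_degree
  refine natDegree_pow_le.trans ?_
  nlinarith

open Polynomial in
theorem coeff_rodrigues (N : ℕ) : (rodrigues N).coeff (2 * N) = (-1) ^ N := by
  have h : (X * (1 - X) : ℝ[X]).natDegree ≤ 2 := by compute_degree
  rw [rodrigues, mul_comm 2 N, coeff_pow_of_natDegree_le h]
  congr 1
  rw [coeff_X_mul, coeff_sub, coeff_X_one, coeff_one]
  simp

open Polynomial in
theorem integral_legendre_sq (N : ℕ) :
    ∫ x in (0 : ℝ)..1, (derivative^[N] (rodrigues N)).eval x ^ 2 =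
      (N.factorial : ℝ) ^ 2 / (2 * N + 1) := by
  have hdeg : (derivative^[N] (rodrigues N)).natDegree ≤ N := by
    have h1 := natDegree_iterate_derivative (rodrigues N) N
    have h2 := natDegree_rodrigues_le N
    omega
  simp only [sq ((derivative^[N] (rodrigues N)).eval _)]
  rw [integral_eval_mul_legendre hdeg, coeff_iterate_derivative, ← two_mul, coeff_rodrigues]
  have h1 : (N.factorial : ℝ) * ((2 * N).descFactorial N : ℝ) = (2 * N).factorial := by
    have := Nat.factorial_mul_descFactorial (show N ≤ 2 * N by omega)
    rw [show 2 * N - N = N by omega] at this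
    exact_mod_cast this
  have h2 : ((2 * N + 1).factorial : ℝ) = (2 * N + 1) * (2 * N).factorial := by
    rw [Nat.factorial_succ]; push_cast; ring
  have h3 : ((-1 : ℝ) ^ N) * (-1) ^ N = 1 := by rw [← mul_pow]; simp
  rw [h2, nsmul_eq_mul, ← h1]
  have : (N.factorial : ℝ) ≠ 0 := by exact_mod_cast Nat.factorial_ne_zero N
  have h4 : ((2 * N).descFactorial N : ℝ) ≠ 0 := by
    intro h
    rw [h, mul_zero] at h1
    exact (Nat.cast_ne_zero.2 (Nat.factorial_ne_zero (2 * N))) h1.symm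
  field_simp
  linear_combination h3

/-- The least squared `L²(0,1)` norm of a polynomial of degree `N` whose `N`-th derivative is the
constant `1`. -/
def legendreConst (N : ℕ) : ℝ := (N.factorial / (2 * N).factorial) ^ 2 / (2 * N + 1)

open Polynomial in
theorem le_integral_eval_sq {N : ℕ} {Q : ℝ[X]} (hQ : Q.natDegree ≤ N) :
    (N.factorial * Q.coeff N) ^ 2 * legendreConst N ≤ ∫ x in (0 : ℝ)..1, Q.eval x ^ 2 := by
  set R := derivative^[N] (rodrigues N) with hR
  have hQR := integral_eval_mul_legendre hQ
  have hRR := integral_legendre_sq N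
  rw [← hR] at hQR hRR
  set A := ∫ x in (0 : ℝ)..1, Q.eval x * R.eval x with hA
  set B := ∫ x in (0 : ℝ)..1, R.eval x ^ 2 with hB
  have hN : (0 : ℝ) < N.factorial := by exact_mod_cast Nat.factorial_pos N
  have hB0 : 0 < B := by rw [hRR]; positivity
  have h : 0 ≤ ∫ x in (0 : ℝ)..1, (Q.eval x - A / B * R.eval x) ^ 2 :=
    intervalIntegral.integral_nonneg zero_le_one fun x _ => sq_nonneg _
  have h' : ∫ x in (0 : ℝ)..1, (Q.eval x - A / B * R.eval x) ^ 2 =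
      (∫ x in (0 : ℝ)..1, Q.eval x ^ 2) - 2 * (A / B) * A + (A / B) ^ 2 * B := by
    rw [hA, hB, ← intervalIntegral.integral_const_mul, ← intervalIntegral.integral_const_mul,
      ← intervalIntegral.integral_sub, ← intervalIntegral.integral_add]
    · congr 1; ext x; ring
    all_goals exact Continuous.intervalIntegrable (by fun_prop) _ _
  have h2 : ∫ x in (0 : ℝ)..1, Q.eval x ^ 2 ≥ A ^ 2 / B := by
    rw [h'] at h
    have : 2 * (A / B) * A - (A / B) ^ 2 * B = A ^ 2 / B := by field_simp; ring
    linarith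
  refine le_trans (le_of_eq ?_) h2
  have h3 : ((2 * N + 1).factorial : ℝ) = (2 * N + 1) * (2 * N).factorial := by
    rw [Nat.factorial_succ]; push_cast; ring
  have h4 : (((-1 : ℝ) ^ N)) ^ 2 = 1 := by rw [← pow_mul, mul_comm, pow_mul]; simp
  rw [hQR, hRR, legendreConst, h3, mul_pow ((-1 : ℝ) ^ N), h4, one_mul]
  have : ((2 * N).factorial : ℝ) ≠ 0 := by exact_mod_cast Nat.factorial_ne_zero _
  field_simp

open Polynomial in
theorem le_integral_eval_sq_of_interval {N : ℕ} {Q : ℝ[X]} (hQ : Q.natDegree ≤ N) {a b : ℝ}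
    (hab : a < b) :
    (b - a) ^ (2 * N + 1) * (N.factorial * Q.coeff N) ^ 2 * legendreConst N ≤
      ∫ x in a..b, Q.eval x ^ 2 := by
  have hL : 0 < b - a := sub_pos.2 hab
  set Q' : ℝ[X] := Q.comp (C (b - a) * X + C a) with hQ'
  have hlin : (C (b - a) * X + C a : ℝ[X]).natDegree = 1 := natDegree_linear hL.ne'
  have hdeg : Q'.natDegree ≤ N := by
    rw [hQ', natDegree_comp, hlin, mul_one]; exact hQ
  have hcoeff : Q'.coeff N = Q.coeff N * (b - a) ^ N := by
    rcases hQ.eq_or_lt with h | h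
    · have := coeff_comp_degree_mul_degree (p := Q) (q := C (b - a) * X + C a) (by rw [hlin]; simp)
      rw [hlin, mul_one, leadingCoeff_linear hL.ne', h] at this
      rw [hQ', this, leadingCoeff, h]
    · rw [coeff_eq_zero_of_natDegree_lt h, coeff_eq_zero_of_natDegree_lt, zero_mul]
      rwa [hQ', natDegree_comp, hlin, mul_one]
  have h := le_integral_eval_sq hdeg
  have h1 : ∫ x in (0 : ℝ)..1, Q'.eval x ^ 2 = (b - a)⁻¹ * ∫ x in a..b, Q.eval x ^ 2 := by
    have := intervalIntegral.integral_comp_mul_add (a := 0) (b := 1)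
      (fun x => Q.eval x ^ 2) hL.ne' a
    simp only [mul_zero, zero_add, mul_one, sub_add_cancel, smul_eq_mul] at this
    rw [← this]
    simp [hQ']
  rw [h1, le_inv_mul_iff₀ hL, hcoeff] at h
  refine le_trans (le_of_eq ?_) h
  ring

/-! ### Asymptotic comparison of the two bounds -/

theorem factorial_le_stirling {N : ℕ} (hN : N ≠ 0) :
    (N.factorial : ℝ) ≤ Real.exp 1 * N * (N / Real.exp 1) ^ N := by
  obtain ⟨k, rfl⟩ := Nat.exists_eq_succ_of_ne_zero hN
  have h := Stirling.stirlingSeq'_antitone (Nat.zero_le k)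
  simp only [Function.comp_apply, Nat.succ_eq_add_one, zero_add] at h
  rw [Stirling.stirlingSeq_one, Stirling.stirlingSeq, div_le_iff₀ (by positivity)] at h
  refine h.trans ?_
  have h1 : √(2 * ((k + 1 : ℕ) : ℝ)) ≤ √2 * ((k + 1 : ℕ) : ℝ) := by
    rw [Real.sqrt_mul (by norm_num)]
    gcongr
    rw [Real.sqrt_le_left (by positivity)]
    have : (1 : ℝ) ≤ ((k + 1 : ℕ) : ℝ) := by exact_mod_cast Nat.le_add_left 1 k
    nlinarith
  calc _ ≤ Real.exp 1 / √2 * (√2 * ((k + 1 : ℕ) : ℝ) *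
        (((k + 1 : ℕ) : ℝ) / Real.exp 1) ^ (k + 1)) := by gcongr
    _ = _ := by
        have : √(2 : ℝ) ≠ 0 := by positivity
        field_simp

theorem inv_le_legendreConst {N : ℕ} (hN : N ≠ 0) :
    ((4 * N / Real.exp 1) ^ (2 * N) * (Real.exp 2 * (3 * N ^ 3)))⁻¹ ≤ legendreConst N := by
  have hN1 : (1 : ℝ) ≤ N := by exact_mod_cast Nat.one_le_iff_ne_zero.2 hN
  have hF : (0 : ℝ) < N.factorial := by exact_mod_cast Nat.factorial_pos N
  have hb : ((2 * N).factorial : ℝ) ≤ 4 ^ N * N.factorial * N.factorial := by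
    have h1 := Nat.choose_mul_factorial_mul_factorial (show N ≤ 2 * N by omega)
    rw [show 2 * N - N = N by omega, ← Nat.centralBinom_eq_two_mul_choose] at h1
    rw [← h1]
    push_cast
    have h2 : (Nat.centralBinom N : ℝ) ≤ 4 ^ N := by
      have h3 := Nat.choose_le_two_pow (2 * N) N
      rw [← Nat.centralBinom_eq_two_mul_choose, pow_mul] at h3
      exact_mod_cast h3
    gcongr
  have h1 : ((4 : ℝ) ^ N * (Real.exp 1 * N * (N / Real.exp 1) ^ N))⁻¹ ≤
      N.factorial / (2 * N).factorial := by
    rw [inv_le_iff_one_le_mul₀ (by positivity), div_mul_eq_mul_div, one_le_div (by positivity)]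
    calc ((2 * N).factorial : ℝ) ≤ 4 ^ N * N.factorial * N.factorial := hb
      _ = N.factorial * (4 ^ N * N.factorial) := by ring
      _ ≤ _ := by gcongr; exact factorial_le_stirling hN
  have h2 : 2 * (N : ℝ) + 1 ≤ 3 * N := by linarith
  calc _ = (((4 : ℝ) ^ N * (Real.exp 1 * N * (N / Real.exp 1) ^ N))⁻¹) ^ 2 / (3 * N) := by
        rw [show Real.exp 2 = Real.exp 1 ^ 2 by rw [← Real.exp_nat_mul]; norm_num]
        rw [show (4 : ℝ) * N / Real.exp 1 = 4 * (N / Real.exp 1) by ring, mul_pow,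
          pow_mul', pow_mul']
        field_simp
    _ ≤ _ := by unfold legendreConst; gcongr

/-- The bases of the two exponentials compare as `8 / 3 < e`; the shift by `d` costs only a
bounded factor. -/
theorem eventually_pow_lt_legendreConst (d : ℕ) :
    ∀ᶠ N : ℕ in Filter.atTop, (2 / (3 * ((N : ℝ) - d))) ^ (2 * N) < legendreConst N := by
  have he : (2.7182818283 : ℝ) < Real.exp 1 := Real.exp_one_gt_d9
  have hρ : |(8 / (3 * Real.exp 1)) ^ 2| < 1 := by
    rw [abs_of_nonneg (by positivity), sq_lt_one_iff₀ (by positivity), div_lt_one (by positivity)]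
    linarith
  have hlim := (tendsto_pow_const_mul_const_pow_of_abs_lt_one 3 hρ).const_mul
    (Real.exp (4 * d) * Real.exp 2 * 3)
  rw [mul_zero] at hlim
  filter_upwards [hlim.eventually (gt_mem_nhds zero_lt_one), Filter.eventually_ge_atTop (2 * d + 1)]
    with N hN hNd
  refine lt_of_lt_of_le ?_ (inv_le_legendreConst (by omega : N ≠ 0))
  have hN0 : (0 : ℝ) < N := by exact_mod_cast (by omega : 0 < N)
  have hNd' : 2 * (d : ℝ) + 1 ≤ N := by exact_mod_cast hNd
  set M : ℝ := (N : ℝ) - d with hM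
  have hd0 : (0 : ℝ) ≤ d := Nat.cast_nonneg d
  have hM0 : 0 < M := by linarith
  have hNM : (N / M) ^ (2 * N) ≤ Real.exp (4 * d) := by
    have h1 : (N : ℝ) / M ≤ Real.exp (d / M) := by
      have h2 := Real.add_one_le_exp (d / M)
      have h3 : (N : ℝ) / M = d / M + 1 := by field_simp; rw [hM]; ring
      rwa [h3]
    calc (N / M) ^ (2 * N) ≤ Real.exp (d / M) ^ (2 * N) := by gcongr
      _ = Real.exp (2 * N * (d / M)) := by rw [← Real.exp_nat_mul]; push_cast; rfl
      _ ≤ _ := by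
        rw [Real.exp_le_exp, ← mul_div_assoc, div_le_iff₀ hM0]
        nlinarith
  rw [lt_inv_comm₀ (by positivity) (by positivity), ← one_div, lt_div_iff₀ (by positivity)]
  calc _ = (N / M) ^ (2 * N) * Real.exp 2 * 3 * (N ^ 3 * ((8 / (3 * Real.exp 1)) ^ 2) ^ N) := by
        have h : (4 * N / Real.exp 1) ^ (2 * N) * (2 / (3 * M)) ^ (2 * N) =
            (N / M) ^ (2 * N) * (8 / (3 * Real.exp 1)) ^ (2 * N) := by
          rw [← mul_pow, ← mul_pow]
          congr 1
          field_simp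
          ring
        rw [← pow_mul]
        linear_combination Real.exp 2 * (3 * N ^ 3) * h
    _ ≤ Real.exp (4 * d) * Real.exp 2 * 3 * (N ^ 3 * ((8 / (3 * Real.exp 1)) ^ 2) ^ N) := by
        gcongr
    _ < 1 := hN

/-! ### Weak derivatives and polynomials -/

theorem setIntegral_Ioo_eq (h : ℝ → ℝ) : ∫ x in Ioo (0 : ℝ) 1, h x = ∫ x in (0 : ℝ)..1, h x := by
  rw [intervalIntegral.integral_of_le zero_le_one, integral_Ioc_eq_integral_Ioo]

/-- Smooth functions on the line with compact support in `(0,1)`. -/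
structure IsTest (φ : ℝ → ℝ) : Prop where
  contDiff : ContDiff ℝ ∞ φ
  hasCompactSupport : HasCompactSupport φ
  tsupport_subset : tsupport φ ⊆ Ioo 0 1

theorem IsTest.deriv {φ : ℝ → ℝ} (h : IsTest φ) : IsTest (deriv φ) :=
  ⟨(contDiff_infty_iff_deriv.1 h.contDiff).2, h.hasCompactSupport.deriv,
    tsupport_deriv_subset.trans h.tsupport_subset⟩

theorem IsTest.iteratedDeriv {φ : ℝ → ℝ} (h : IsTest φ) (r : ℕ) : IsTest (iteratedDeriv r φ) := by
  induction r with
  | zero => simpa using h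
  | succ r ih => rw [iteratedDeriv_succ]; exact ih.deriv

theorem IsTest.continuous {φ : ℝ → ℝ} (h : IsTest φ) : Continuous φ := h.contDiff.continuous

theorem IsTest.hasDerivAt {φ : ℝ → ℝ} (h : IsTest φ) (x : ℝ) :
    HasDerivAt φ (_root_.deriv φ x) x :=
  (h.contDiff.differentiable (by simp) x).hasDerivAt

theorem IsTest.eq_zero {φ : ℝ → ℝ} (h : IsTest φ) {x : ℝ} (hx : x ∉ Ioo (0 : ℝ) 1) : φ x = 0 :=
  image_eq_zero_of_notMem_tsupport fun hx' => hx (h.tsupport_subset hx')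

theorem IsTest.integral_deriv {φ : ℝ → ℝ} (h : IsTest φ) (x : ℝ) :
    ∫ t in (0 : ℝ)..x, _root_.deriv φ t = φ x := by
  rw [intervalIntegral.integral_eq_sub_of_hasDerivAt (fun t _ => h.hasDerivAt t)
    (h.deriv.continuous.intervalIntegrable _ _), h.eq_zero (x := 0) (by simp), sub_zero]

open Polynomial in
theorem IsTest.integral_eval_mul_iteratedDeriv {φ : ℝ → ℝ} (h : IsTest φ) (P : ℝ[X]) (r : ℕ) :
    ∫ x in (0 : ℝ)..1, P.eval x * _root_.iteratedDeriv r φ x =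
      (-1) ^ r * ∫ x in (0 : ℝ)..1, (derivative^[r] P).eval x * φ x := by
  induction r generalizing P with
  | zero => simp
  | succ r ih =>
    rw [iteratedDeriv_succ, intervalIntegral.integral_mul_deriv_eq_deriv_mul
      (fun x _ => P.hasDerivAt x) (fun x _ => (h.iteratedDeriv r).hasDerivAt x)
      ((derivative P).continuous.intervalIntegrable _ _)
      ((h.iteratedDeriv r).deriv.continuous.intervalIntegrable _ _), ih,
      (h.iteratedDeriv r).eq_zero (x := 0) (by simp),
      (h.iteratedDeriv r).eq_zero (x := 1) (by simp), Function.iterate_succ_apply]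
    ring

/-- A test function of zero mean is the derivative of a test function. -/
theorem IsTest.exists_deriv_eq {χ : ℝ → ℝ} (h : IsTest χ) (h0 : ∫ x in (0 : ℝ)..1, χ x = 0) :
    ∃ φ, IsTest φ ∧ _root_.deriv φ = χ := by
  set φ : ℝ → ℝ := fun x => ∫ t in (0 : ℝ)..x, χ t with hφ
  have hd : ∀ x, HasDerivAt φ (χ x) x := fun x =>
    intervalIntegral.integral_hasDerivAt_right (h.continuous.intervalIntegrable _ _)
      (h.continuous.stronglyMeasurableAtFilter _ _) h.continuous.continuousAt
  have hderiv : _root_.deriv φ = χ := funext fun x => (hd x).deriv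
  have hK : IsCompact (insert (1 / 2) (tsupport χ)) := h.hasCompactSupport.isCompact.insert _
  have hKsub : insert (1 / 2) (tsupport χ) ⊆ Ioo (0 : ℝ) 1 :=
    insert_subset (by norm_num) h.tsupport_subset
  obtain ⟨α, hα, hα'⟩ := hK.exists_isLeast (insert_nonempty _ _)
  obtain ⟨β, hβ, hβ'⟩ := hK.exists_isGreatest (insert_nonempty _ _)
  have hz : ∀ x, x ∉ Icc α β → χ x = 0 := fun x hx =>
    image_eq_zero_of_notMem_tsupport fun hx' =>
      hx ⟨hα' (mem_insert_of_mem _ hx'), hβ' (mem_insert_of_mem _ hx')⟩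
  have hsupp : Function.support φ ⊆ Icc α β := by
    intro x hx
    by_contra hx'
    apply hx
    have hx2 : x < α ∨ β < x := by
      by_contra hc
      push Not at hc
      exact hx' hc
    rcases hx2 with hlt | hlt
    · refine intervalIntegral.integral_zero_ae (Filter.Eventually.of_forall fun t ht => hz t ?_)
      intro ht'
      have h1 := (hKsub hα).1
      rw [mem_uIoc] at ht
      rcases ht with ht | ht <;> linarith [ht.1, ht.2, ht'.1]
    · have h1 := (hKsub hβ).2
      have h2 : ∫ t in x..1, χ t = 0 := by
        refine intervalIntegral.integral_zero_ae (Filter.Eventually.of_forall fun t ht => hz t ?_)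
        intro ht'
        rw [mem_uIoc] at ht
        rcases ht with ht | ht <;> linarith [ht.1, ht.2, ht'.2]
      have h3 := intervalIntegral.integral_add_adjacent_intervals
        (h.continuous.intervalIntegrable (μ := volume) 0 x)
        (h.continuous.intervalIntegrable (μ := volume) x 1)
      rw [h2, h0, add_zero] at h3
      exact h3
  refine ⟨φ, ⟨contDiff_infty_iff_deriv.2 ⟨fun x => (hd x).differentiableAt, ?_⟩,
    HasCompactSupport.of_support_subset_isCompact isCompact_Icc hsupp, ?_⟩, hderiv⟩
  · rw [hderiv]; exact h.contDiff
  · exact (closure_minimal hsupp isClosed_Icc).trans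
      (Icc_subset_Ioo (hKsub hα).1 (hKsub hβ).2)

theorem exists_isTest_integral_eq_one : ∃ η, IsTest η ∧ ∫ x in (0 : ℝ)..1, η x = 1 := by
  let b : ContDiffBump (1 / 2 : ℝ) := ⟨1 / 8, 1 / 4, by norm_num, by norm_num⟩
  have hsub : tsupport (b.normed volume) ⊆ Ioo 0 1 := by
    rw [b.tsupport_normed_eq, Real.closedBall_eq_Icc]
    exact Icc_subset_Ioo (by norm_num [b]) (by norm_num [b])
  refine ⟨b.normed volume, ⟨b.contDiff_normed, b.hasCompactSupport_normed, hsub⟩, ?_⟩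
  rw [← setIntegral_Ioo_eq, setIntegral_eq_integral_of_forall_compl_eq_zero
    fun x hx => image_eq_zero_of_notMem_tsupport fun hx' => hx (hsub hx'), b.integral_normed]

open Polynomial in
/-- The du Bois-Reymond lemma: a function whose weak derivative of order `r` vanishes is a
polynomial of degree less than `r`. -/
theorem exists_polynomial_of_integral_iteratedDeriv_eq_zero (r : ℕ) {f : ℝ → ℝ}
    (hf : IntegrableOn f (Ioo 0 1))
    (h : ∀ φ, IsTest φ → ∫ x in (0 : ℝ)..1, f x * iteratedDeriv r φ x = 0) :
    ∃ P : ℝ[X], P.degree < r ∧ f =ᵐ[volume.restrict (Ioo (0 : ℝ) 1)] fun x => P.eval x := by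
  induction r generalizing f with
  | zero =>
    refine ⟨0, by simp, ?_⟩
    have := isOpen_Ioo.ae_eq_zero_of_integral_contDiff_smul_eq_zero
      hf.locallyIntegrableOn fun g hg hg' hg'' => ?_
    · rw [Filter.EventuallyEq, ae_restrict_iff' measurableSet_Ioo]
      simpa using this
    · rw [← setIntegral_eq_integral_of_forall_compl_eq_zero (s := Ioo (0 : ℝ) 1),
        setIntegral_Ioo_eq]
      · simpa [mul_comm] using h g ⟨hg, hg', hg''⟩
      · intro x hx
        rw [IsTest.eq_zero ⟨hg, hg', hg''⟩ hx, zero_smul]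
  | succ r ih =>
    obtain ⟨η, hη, hη1⟩ := exists_isTest_integral_eq_one
    have hfi : IntervalIntegrable f volume 0 1 :=
      (intervalIntegrable_iff_integrableOn_Ioo_of_le zero_le_one).2 hf
    have hfm : ∀ {g : ℝ → ℝ}, Continuous g → IntervalIntegrable (fun x => f x * g x) volume 0 1 :=
      fun hg => hfi.mul_continuousOn hg.continuousOn
    set c : ℝ := ∫ x in (0 : ℝ)..1, f x * iteratedDeriv r η x with hc
    have hψ : ∀ ψ, IsTest ψ → ∫ x in (0 : ℝ)..1, f x * iteratedDeriv r ψ x =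
        c * ∫ x in (0 : ℝ)..1, ψ x := by
      intro ψ hψ
      set I := ∫ x in (0 : ℝ)..1, ψ x with hI
      have hχ : IsTest (fun x => ψ x - I * η x) := by
        have hsub : tsupport (fun x => ψ x - I * η x) ⊆ tsupport ψ ∪ tsupport η := by
          refine closure_minimal (fun x hx => ?_)
            ((isClosed_tsupport ψ).union (isClosed_tsupport η))
          by_contra hx'
          rw [mem_union, not_or] at hx'
          apply hx
          simp [image_eq_zero_of_notMem_tsupport hx'.1, image_eq_zero_of_notMem_tsupport hx'.2]
        refine ⟨hψ.contDiff.sub (contDiff_const.mul hη.contDiff), ?_,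
          hsub.trans (union_subset hψ.tsupport_subset hη.tsupport_subset)⟩
        exact (hψ.hasCompactSupport.isCompact.union
          hη.hasCompactSupport.isCompact).of_isClosed_subset (isClosed_tsupport _) hsub
      have hχ0 : ∫ x in (0 : ℝ)..1, (ψ x - I * η x) = 0 := by
        rw [intervalIntegral.integral_sub (hψ.continuous.intervalIntegrable _ _)
          ((hη.continuous.intervalIntegrable _ _).const_mul _),
          intervalIntegral.integral_const_mul, hη1]
        simp [hI]
      obtain ⟨φ, hφ, hφd⟩ := hχ.exists_deriv_eq hχ0
      have h1 := h φ hφ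
      have h2 : ∀ x, iteratedDeriv (r + 1) φ x = iteratedDeriv r ψ x - I * iteratedDeriv r η x := by
        intro x
        have hr : ((r : ℕ) : ℕ∞ω) ≤ ∞ := by exact_mod_cast le_top
        rw [iteratedDeriv_succ', hφd, iteratedDeriv_fun_sub (hψ.contDiff.of_le hr).contDiffAt
          (contDiff_const.mul (hη.contDiff.of_le hr)).contDiffAt, iteratedDeriv_const_mul_field]
      simp only [h2] at h1
      have h3 : ∀ x, f x * (iteratedDeriv r ψ x - I * iteratedDeriv r η x) =
        f x * iteratedDeriv r ψ x - I * (f x * iteratedDeriv r η x) := fun x => by ring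
      simp only [h3] at h1
      rw [intervalIntegral.integral_sub (hfm (hψ.iteratedDeriv r).continuous)
        ((hfm (hη.iteratedDeriv r).continuous).const_mul _),
        intervalIntegral.integral_const_mul, ← hc] at h1
      linarith
    -- The polynomial whose pairing with `ψ⁽ʳ⁾` is `c * ∫ ψ` for every test function `ψ`.
    set Q : ℝ[X] := Polynomial.C ((-1) ^ r * c / r.factorial) * X ^ r with hQ
    have hQd : derivative^[r] Q = Polynomial.C ((-1) ^ r * c) := by
      rw [hQ, iterate_derivative_C_mul, iterate_derivative_X_pow_eq_C_mul, Nat.descFactorial_self,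
        Nat.sub_self, pow_zero, mul_one, ← C_mul]
      congr 1
      have := Nat.factorial_ne_zero r
      field_simp
    have hQi : IntegrableOn (fun x => Q.eval x) (Ioo 0 1) :=
      (Q.continuous.integrableOn_Icc (a := 0) (b := 1)).mono_set Ioo_subset_Icc_self
    obtain ⟨P, hP, hPf⟩ := ih (f := fun x => f x - Q.eval x) (hf.sub hQi) fun ψ hψt => by
      simp only [sub_mul]
      have hQψ : IntervalIntegrable (fun x => Q.eval x * iteratedDeriv r ψ x) volume 0 1 :=
        (Q.continuous.mul (hψt.iteratedDeriv r).continuous).intervalIntegrable _ _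
      rw [intervalIntegral.integral_sub (hfm (hψt.iteratedDeriv r).continuous) hQψ,
        hψ ψ hψt, hψt.integral_eval_mul_iteratedDeriv, hQd]
      simp only [eval_C, intervalIntegral.integral_const_mul]
      rw [← mul_assoc, ← mul_assoc, ← mul_pow]
      simp
    refine ⟨P + Q, ?_, ?_⟩
    · refine (degree_add_le _ _).trans_lt (max_lt (hP.trans ?_) ?_)
      · exact_mod_cast Nat.lt_succ_self r
      · exact (degree_C_mul_X_pow_le _ _).trans_lt (by exact_mod_cast Nat.lt_succ_self r)
    · filter_upwards [hPf] with x hx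
      rw [eval_add, ← hx]
      ring

/-! ### The Volterra operator on `L²(0,1)` -/

theorem intervalIntegrable_coe (f : L2) : IntervalIntegrable f volume 0 1 :=
  (intervalIntegrable_iff_integrableOn_Ioo_of_le zero_le_one).2
    ((Lp.memLp f).integrable one_le_two)

theorem intervalIntegrable_coe_of_mem (f : L2) {a b : ℝ} (ha : a ∈ Icc (0 : ℝ) 1)
    (hb : b ∈ Icc (0 : ℝ) 1) : IntervalIntegrable f volume a b :=
  (intervalIntegrable_coe f).mono_set (by
    rw [uIcc_of_le zero_le_one]; exact (convex_Icc (0 : ℝ) 1).ordConnected.uIcc_subset ha hb)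

theorem integral_congr_of_ae {f g : ℝ → ℝ} (h : f =ᵐ[volume.restrict (Ioo (0 : ℝ) 1)] g) {a b : ℝ}
    (ha : a ∈ Icc (0 : ℝ) 1) (hb : b ∈ Icc (0 : ℝ) 1) :
    ∫ x in a..b, f x = ∫ x in a..b, g x := by
  refine intervalIntegral.integral_congr_ae ?_
  rw [Filter.EventuallyEq, ae_restrict_iff' measurableSet_Ioo] at h
  filter_upwards [h, compl_mem_ae_iff.2 (measure_singleton (μ := volume) (1 : ℝ))]
    with x hx hx1 hxm
  have hx1' : x ≠ 1 := hx1
  rw [mem_uIoc] at hxm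
  refine hx ⟨?_, lt_of_le_of_ne ?_ hx1'⟩
  · rcases hxm with hm | hm <;> linarith [hm.1, ha.1, hb.1]
  · rcases hxm with hm | hm <;> linarith [hm.2, ha.2, hb.2]

theorem continuousOn_primitive_coe (f : L2) :
    ContinuousOn (fun x => ∫ t in (0 : ℝ)..x, f t) (Icc 0 1) := by
  rw [← uIcc_of_le (zero_le_one' ℝ)]
  exact ((intervalIntegrable_coe f).absolutelyContinuousOnInterval_intervalIntegral
    (c := 0) (by simp)).continuousOn

theorem memLp_of_continuousOn {F : ℝ → ℝ} (hF : ContinuousOn F (Icc 0 1)) :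
    MemLp F 2 (volume.restrict (Ioo (0 : ℝ) 1)) := by
  obtain ⟨M, hM⟩ := isCompact_Icc.exists_bound_of_continuousOn hF
  refine MemLp.of_bound ((hF.mono Ioo_subset_Icc_self).aestronglyMeasurable measurableSet_Ioo) M ?_
  filter_upwards [ae_restrict_mem measurableSet_Ioo] with x hx
  exact hM x (Ioo_subset_Icc_self hx)

/-- Integration from `0`, as an operator on `L²(0,1)`. -/
def volterra : L2 →ₗ[ℝ] L2 where
  toFun f := (memLp_of_continuousOn (continuousOn_primitive_coe f)).toLp _
  map_add' f g := by
    rw [← MemLp.toLp_add]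
    refine MemLp.toLp_congr _ _ ?_
    filter_upwards [ae_restrict_mem measurableSet_Ioo] with x hx
    have hx' := Ioo_subset_Icc_self hx
    have h0 : (0 : ℝ) ∈ Icc (0 : ℝ) 1 := by simp
    rw [Pi.add_apply, ← intervalIntegral.integral_add (intervalIntegrable_coe_of_mem f h0 hx')
      (intervalIntegrable_coe_of_mem g h0 hx')]
    exact integral_congr_of_ae (Lp.coeFn_add f g) h0 hx'
  map_smul' c f := by
    rw [RingHom.id_apply, ← MemLp.toLp_const_smul]
    refine MemLp.toLp_congr _ _ ?_
    filter_upwards [ae_restrict_mem measurableSet_Ioo] with x hx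
    rw [Pi.smul_apply, smul_eq_mul, ← intervalIntegral.integral_const_mul]
    exact integral_congr_of_ae (Lp.coeFn_smul c f) (by simp) (Ioo_subset_Icc_self hx)

theorem coeFn_volterra (f : L2) : volterra f =ᵐ[volume.restrict (Ioo (0 : ℝ) 1)]
    fun x => ∫ t in (0 : ℝ)..x, f t :=
  MemLp.coeFn_toLp (memLp_of_continuousOn (continuousOn_primitive_coe f))

/-- The constant function `1` in `L²(0,1)`. -/
def one : L2 := (memLp_const (1 : ℝ)).toLp _

theorem coeFn_one : one =ᵐ[volume.restrict (Ioo (0 : ℝ) 1)] fun _ => 1 := MemLp.coeFn_toLp _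

theorem inner_eq_integral (f g : L2) : inner ℝ f g = ∫ x in (0 : ℝ)..1, f x * g x := by
  rw [L2.inner_def, setIntegral_Ioo_eq]
  simp [mul_comm]

theorem integral_congr_mul {f f' g g' : ℝ → ℝ} (hf : f =ᵐ[volume.restrict (Ioo (0 : ℝ) 1)] f')
    (hg : g =ᵐ[volume.restrict (Ioo (0 : ℝ) 1)] g') :
    ∫ x in (0 : ℝ)..1, f x * g x = ∫ x in (0 : ℝ)..1, f' x * g' x :=
  integral_congr_of_ae (hf.mul hg) (by simp) (by simp)

theorem norm_sq_eq_integral (f : L2) {F : ℝ → ℝ} (h : f =ᵐ[volume.restrict (Ioo (0 : ℝ) 1)] F) :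
    ‖f‖ ^ 2 = ∫ x in (0 : ℝ)..1, F x ^ 2 := by
  rw [← real_inner_self_eq_norm_sq, inner_eq_integral, integral_congr_mul h h]
  simp only [sq]

theorem norm_one_eq : ‖one‖ = 1 := by
  have h := norm_sq_eq_integral one coeFn_one
  simp only [one_pow, intervalIntegral.integral_const, sub_zero, smul_eq_mul, mul_one] at h
  exact (pow_eq_one_iff_of_nonneg (norm_nonneg _) two_ne_zero).1 h

theorem inner_one_eq (f : L2) : inner ℝ f one = ∫ x in (0 : ℝ)..1, f x := by
  rw [inner_eq_integral, integral_congr_mul (Filter.EventuallyEq.refl _ _) coeFn_one]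
  simp

theorem inner_volterra_add (d e : L2) :
    inner ℝ (volterra d) e + inner ℝ d (volterra e) = inner ℝ d one * inner ℝ e one := by
  rw [inner_one_eq, inner_one_eq, inner_eq_integral, inner_eq_integral,
    integral_congr_mul (coeFn_volterra d) (Filter.EventuallyEq.refl _ _),
    integral_congr_mul (Filter.EventuallyEq.refl _ _) (coeFn_volterra e)]
  exact integral_primitive_mul_add (intervalIntegrable_coe d) (intervalIntegrable_coe e)

theorem IsTest.integral_volterra_mul_deriv {φ : ℝ → ℝ} (h : IsTest φ) (f : L2) :
    ∫ x in (0 : ℝ)..1, volterra f x * _root_.deriv φ x = -∫ x in (0 : ℝ)..1, f x * φ x := by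
  rw [integral_congr_mul (coeFn_volterra f) (Filter.EventuallyEq.refl _ _)]
  have := integral_primitive_mul_add (intervalIntegrable_coe f)
    (h.deriv.continuous.intervalIntegrable 0 1)
  simp only [h.integral_deriv] at this
  rw [h.eq_zero (x := 1) (by simp)] at this
  linarith

theorem IsTest.integral_iterate_volterra_mul {φ : ℝ → ℝ} (h : IsTest φ) (g : L2) (r : ℕ) :
    ∫ x in (0 : ℝ)..1, (volterra^[r] g) x * _root_.iteratedDeriv r φ x =
      (-1) ^ r * ∫ x in (0 : ℝ)..1, g x * φ x := by
  induction r with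
  | zero => simp
  | succ r ih =>
    rw [iteratedDeriv_succ, Function.iterate_succ_apply',
      (h.iteratedDeriv r).integral_volterra_mul_deriv, ih]
    ring

/-- A function with weak derivative `g` of order `r` is an iterated integral of `g` up to a
polynomial of degree less than `r`. -/
theorem HasWeakDeriv.exists_polynomial {r : ℕ} {f g : L2} (h : HasWeakDeriv r f g) :
    ∃ P : ℝ[X], P.degree < r ∧
      (f - volterra^[r] g : L2) =ᵐ[volume.restrict (Ioo (0 : ℝ) 1)] fun x => P.eval x := by
  refine exists_polynomial_of_integral_iteratedDeriv_eq_zero r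
    ((Lp.memLp (f - volterra^[r] g : L2)).integrable one_le_two) fun φ hφ => ?_
  have h1 := h φ hφ.contDiff hφ.hasCompactSupport hφ.tsupport_subset
  rw [setIntegral_Ioo_eq, setIntegral_Ioo_eq] at h1
  have h2 := hφ.integral_iterate_volterra_mul g r
  rw [integral_congr_mul (Lp.coeFn_sub _ _) (Filter.EventuallyEq.refl _ _)]
  simp only [Pi.sub_apply, sub_mul]
  have hc := (hφ.iteratedDeriv r).continuous.continuousOn (s := uIcc 0 1)
  rw [intervalIntegral.integral_sub ((intervalIntegrable_coe _).mul_continuousOn hc)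
    ((intervalIntegrable_coe _).mul_continuousOn hc), h1, h2, sub_self]

/-! ### Splines and the uniform mesh -/

theorem mem_splineSpace_of_polynomial {p : ℕ} (k : ℤ) (n : ℕ+) {f : L2} {P : ℝ[X]}
    (hP : P.natDegree ≤ p) (h : f =ᵐ[volume.restrict (Ioo (0 : ℝ) 1)] fun x => P.eval x) :
    f ∈ splineSpace p k n :=
  ⟨fun x => P.eval x, ⟨fun _ => by
    simpa [Polynomial.coe_aeval_eq_eval] using (P.contDiff_aeval (𝕜 := ℝ) _).contDiffOn,
    fun _ => ⟨P, hP, fun _ _ => rfl⟩⟩, h⟩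

theorem one_mem_splineSpace (p : ℕ) (k : ℤ) (n : ℕ+) : one ∈ splineSpace p k n :=
  mem_splineSpace_of_polynomial k n (P := 1) (by simp) (by simpa using coeFn_one)

theorem splineSpace_anti_smoothness (p : ℕ) {k l : ℤ} (hkl : k ≤ l) (n : ℕ+) :
    splineSpace p l n ≤ splineSpace p k n := by
  rintro f ⟨s, ⟨hs, hs'⟩, hfs⟩
  refine ⟨s, ⟨fun hk => (hs (hk.trans hkl)).of_le ?_, hs'⟩, hfs⟩
  exact_mod_cast Int.toNat_le_toNat hkl

theorem segment_bounds (n : ℕ+) (j : Fin n) :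
    (j : ℝ) / n ∈ Icc (0 : ℝ) 1 ∧ ((j : ℝ) + 1) / n ∈ Icc (0 : ℝ) 1 ∧
      (j : ℝ) / n < ((j : ℝ) + 1) / n ∧ ((j : ℝ) + 1) / n - (j : ℝ) / n = 1 / n := by
  have hn : (0 : ℝ) < (n : ℝ) := by exact_mod_cast n.pos
  have hj : (j : ℝ) + 1 ≤ n := by exact_mod_cast j.2
  refine ⟨⟨by positivity, ?_⟩, ⟨by positivity, ?_⟩, by gcongr; linarith, by ring⟩
  · rw [div_le_one hn]; linarith
  · rwa [div_le_one hn]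

theorem norm_sq_eq_sum_segment (n : ℕ+) (d : L2) (G : Fin n → ℝ → ℝ)
    (h : ∀ᵐ x ∂(volume.restrict (Ioo (0 : ℝ) 1)), ∀ j, x ∈ segment n j → d x = G j x) :
    ‖d‖ ^ 2 = ∑ j : Fin n, ∫ x in ((j : ℝ) / n)..(((j : ℝ) + 1) / n), G j x ^ 2 := by
  have hn : (0 : ℝ) < (n : ℝ) := by exact_mod_cast n.pos
  have hd2 : IntervalIntegrable (fun x => d x ^ 2) volume 0 1 :=
    (intervalIntegrable_iff_integrableOn_Ioo_of_le zero_le_one).2 (Lp.memLp d).integrable_sq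
  rw [norm_sq_eq_integral d (Filter.EventuallyEq.refl _ _)]
  have hsum := intervalIntegral.sum_integral_adjacent_intervals (μ := volume)
    (f := fun x => d x ^ 2) (a := fun i : ℕ => (i : ℝ) / n) (n := n) fun i hi => by
      refine hd2.mono_set ?_
      rw [uIcc_of_le (zero_le_one' ℝ)]
      have := segment_bounds n ⟨i, hi⟩
      refine (convex_Icc (0 : ℝ) 1).ordConnected.uIcc_subset this.1 ?_
      simpa using this.2.1
  simp only [Nat.cast_zero, zero_div] at hsum
  rw [div_self hn.ne'] at hsum
  rw [← hsum, Finset.sum_range]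
  refine Finset.sum_congr rfl fun j _ => ?_
  obtain ⟨h0, h1, h2, -⟩ := segment_bounds n j
  push_cast
  refine intervalIntegral.integral_congr_ae ?_
  rw [ae_restrict_iff' measurableSet_Ioo] at h
  filter_upwards [h, compl_mem_ae_iff.2
    (measure_singleton (μ := volume) (((j : ℝ) + 1) / n))] with x hx hx1 hxm
  rw [uIoc_of_le h2.le] at hxm
  have hx2 : x < ((j : ℝ) + 1) / n := lt_of_le_of_ne hxm.2 hx1
  rw [hx ⟨h0.1.trans_lt hxm.1, hx2.trans_le h1.2⟩ j ⟨hxm.1.le, hx2⟩]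

open Polynomial in
theorem exists_derivative_eq {P : ℝ[X]} {q : ℕ} (hP : P.natDegree ≤ q) :
    ∃ R : ℝ[X], derivative R = P ∧ R.natDegree ≤ q + 1 := by
  refine ⟨∑ i ∈ Finset.range (q + 1), monomial (i + 1) (P.coeff i / (i + 1)), ?_, ?_⟩
  · conv_rhs => rw [P.as_sum_range' (q + 1) (by omega)]
    rw [derivative_sum]
    refine Finset.sum_congr rfl fun i _ => ?_
    rw [derivative_monomial, Nat.add_sub_cancel]
    have : (i : ℝ) + 1 ≠ 0 := by positivity
    push_cast
    field_simp
  · refine natDegree_sum_le_of_forall_le _ _ fun i hi => (natDegree_monomial_le _).trans ?_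
    have := Finset.mem_range.1 hi
    omega

/-- Integration raises both the degree and the smoothness of a spline of maximal smoothness. -/
theorem volterra_mem_splineSpace (q : ℕ) (n : ℕ+) {f : L2}
    (hf : f ∈ splineSpace q ((q : ℤ) - 1) n) :
    volterra f ∈ splineSpace (q + 1) (((q + 1 : ℕ) : ℤ) - 1) n := by
  obtain ⟨σ, ⟨hσ, hσ'⟩, hfσ⟩ := hf
  have h01 : (0 : ℝ) ∈ Icc (0 : ℝ) 1 := by simp
  set F : ℝ → ℝ := fun x => ∫ t in (0 : ℝ)..x, f t with hF
  have hFσ : ∀ x ∈ Icc (0 : ℝ) 1, F x = ∫ t in (0 : ℝ)..x, σ t := fun x hx =>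
    integral_congr_of_ae hfσ h01 hx
  have hσi : IntegrableOn σ (Ioo 0 1) := ((Lp.memLp f).integrable one_le_two).congr hfσ
  have hσI : ∀ {a b : ℝ}, a ∈ Icc (0 : ℝ) 1 → b ∈ Icc (0 : ℝ) 1 →
      IntervalIntegrable σ volume a b := fun ha hb =>
    ((intervalIntegrable_iff_integrableOn_Ioo_of_le zero_le_one).2 hσi).mono_set (by
      rw [uIcc_of_le zero_le_one]; exact (convex_Icc (0 : ℝ) 1).ordConnected.uIcc_subset ha hb)
  refine ⟨F, ⟨fun _ => ?_, fun j => ?_⟩, coeFn_volterra f⟩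
  · rw [show (((q + 1 : ℕ) : ℤ) - 1).toNat = q by omega]
    rcases q with - | r
    · exact contDiffOn_zero.2 (continuousOn_primitive_coe f)
    · have hσc := hσ (by omega)
      rw [show (((r + 1 : ℕ) : ℤ) - 1).toNat = r by omega] at hσc
      have hd : ∀ x ∈ Icc (0 : ℝ) 1, HasDerivWithinAt F (σ x) (Icc 0 1) x := by
        intro x hx
        have : Fact (x ∈ Icc (0 : ℝ) 1) := ⟨hx⟩
        refine (intervalIntegral.integral_hasDerivWithinAt_right (hσI h01 hx) (s := Icc 0 1)
          (t := Icc 0 1) ?_ (hσc.continuousOn x hx)).congr hFσ (hFσ x hx)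
        exact hσc.continuousOn.stronglyMeasurableAtFilter_nhdsWithin measurableSet_Icc x
      have hu : UniqueDiffOn ℝ (Icc (0 : ℝ) 1) := uniqueDiffOn_Icc zero_lt_one
      have h1 : ContDiffOn ℝ ((r : ℕ∞ω) + 1) F (Icc 0 1) := by
        refine (contDiffOn_succ_iff_derivWithin hu).2
          ⟨fun x hx => (hd x hx).differentiableWithinAt, fun h => ?_, ?_⟩
        · exact absurd h (by simp)
        · exact hσc.congr fun x hx => (hd x hx).derivWithin (hu x hx)
      exact_mod_cast h1
  · obtain ⟨P, hP, hPσ⟩ := hσ' j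
    obtain ⟨R, hR, hRq⟩ := exists_derivative_eq hP
    obtain ⟨ha, hb, hab, -⟩ := segment_bounds n j
    set a : ℝ := (j : ℝ) / n
    refine ⟨R + Polynomial.C (F a - R.eval a), ?_, fun x hx => ?_⟩
    · exact Polynomial.natDegree_add_le_of_degree_le hRq (by simp)
    · have hx01 : x ∈ Icc (0 : ℝ) 1 := ⟨ha.1.trans hx.1, hx.2.le.trans hb.2⟩
      have h1 : ∫ t in a..x, σ t = R.eval x - R.eval a := by
        rw [intervalIntegral.integral_congr (g := fun t => P.eval t)]
        · refine intervalIntegral.integral_eq_sub_of_hasDerivAt (f := fun t => R.eval t)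
            (fun t _ => ?_) (P.continuous.intervalIntegrable _ _)
          rw [← hR]
          exact R.hasDerivAt t
        · intro t ht
          rw [uIcc_of_le hx.1] at ht
          exact hPσ t ⟨ht.1, ht.2.trans_lt hx.2⟩
      have h2 := intervalIntegral.integral_add_adjacent_intervals (hσI h01 ha) (hσI ha hx01)
      rw [← hFσ a ha, ← hFσ x hx01, h1] at h2
      simp only [Polynomial.eval_add, Polynomial.eval_C]
      linarith

/-- Piecewise constant approximation of a primitive, from the Poincaré inequality on each
segment. -/
theorem norm_volterra_sub_starProjection_le (n : ℕ+) (u : L2) :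
    ‖volterra u - (splineSpace 0 (((0 : ℕ) : ℤ) - 1) n).starProjection (volterra u)‖ ≤
      1 / (3 * n) * ‖u‖ := by
  have hn : (0 : ℝ) < (n : ℝ) := by exact_mod_cast n.pos
  have hu2 : IntervalIntegrable (fun x => u x ^ 2) volume 0 1 :=
    (intervalIntegrable_iff_integrableOn_Ioo_of_le zero_le_one).2 (Lp.memLp u).integrable_sq
  have hP : ∀ j : Fin n, ∃ c : ℝ, ∫ x in ((j : ℝ) / n)..(((j : ℝ) + 1) / n),
      ((∫ t in (0 : ℝ)..x, u t) - c) ^ 2 ≤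
        (1 / (3 * n)) ^ 2 * ∫ x in ((j : ℝ) / n)..(((j : ℝ) + 1) / n), u x ^ 2 := by
    intro j
    obtain ⟨ha, hb, hab, hL⟩ := segment_bounds n j
    obtain ⟨c, hc⟩ := exists_integral_primitive_sub_sq_le hab
      (intervalIntegrable_coe_of_mem u ha hb)
      (hu2.mono_set (by
        rw [uIcc_of_le (zero_le_one' ℝ)]
        exact (convex_Icc (0 : ℝ) 1).ordConnected.uIcc_subset ha hb))
    refine ⟨(∫ t in (0 : ℝ)..((j : ℝ) / n), u t) + c, ?_⟩
    rw [hL] at hc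
    have h3 : (1 : ℝ) / n / 3 = 1 / (3 * n) := by field_simp
    rw [h3] at hc
    refine le_trans (le_of_eq ?_) hc
    refine intervalIntegral.integral_congr fun x hx => ?_
    rw [uIcc_of_le hab.le] at hx
    have hx01 : x ∈ Icc (0 : ℝ) 1 := ⟨ha.1.trans hx.1, hx.2.trans hb.2⟩
    have := intervalIntegral.integral_add_adjacent_intervals
      (intervalIntegrable_coe_of_mem u (a := 0) (by simp) ha)
      (intervalIntegrable_coe_of_mem u ha hx01)
    simp only [← this]
    ring
  choose c hc using hP
  set P : Fin n → ℝ[X] := fun j => Polynomial.C (c j) with hPdef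
  set s : ℝ → ℝ := fun x => ∑ j, (segment n j).indicator (fun y => (P j).eval y) x with hs
  have hsj : ∀ j, ∀ x ∈ segment n j, s x = c j := by
    intro j x hx
    rw [hs]
    simp only
    rw [Finset.sum_eq_single j (fun i _ hij =>
      indicator_of_notMem (fun hi => hij (segment_unique n hi hx)) _) (by simp)]
    simp [hx, hPdef]
  have hsm : (memLp_piecewise n P).toLp s ∈ splineSpace 0 (((0 : ℕ) : ℤ) - 1) n :=
    ⟨s, ⟨fun h => absurd h (by norm_num), fun j => ⟨P j, by simp [hPdef], fun x hx => by
      rw [hsj j x hx]; simp [hPdef]⟩⟩, MemLp.coeFn_toLp _⟩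
  refine (norm_sub_starProjection_le _ _ hsm).trans ?_
  refine (pow_le_pow_iff_left₀ (norm_nonneg _) (by positivity) two_ne_zero).1 ?_
  rw [mul_pow, norm_sq_eq_sum_segment n _ (fun j x => (∫ t in (0 : ℝ)..x, u t) - c j),
    norm_sq_eq_sum_segment n u (fun _ => u) (Filter.Eventually.of_forall fun _ _ _ => rfl),
    Finset.mul_sum]
  · exact Finset.sum_le_sum fun j _ => hc j
  · filter_upwards [Lp.coeFn_sub (volterra u) ((memLp_piecewise n P).toLp s), coeFn_volterra u,
      MemLp.coeFn_toLp (memLp_piecewise n P)] with x h1 h2 h3 j hj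
    rw [h1, Pi.sub_apply, h2, h3]
    congr 1
    exact hsj j x hj

/-! ### Bounds for the best constants -/

/-- The upper bound for maximally smooth splines. -/
theorem pow_mem_admissibleConstants (p : ℕ) (n : ℕ+) :
    (1 / (3 * n : ℝ)) ^ (p + 1) ∈ admissibleConstants p ((p : ℤ) - 1) n p := by
  intro f _ g hfg
  obtain ⟨P, hP, hfP⟩ := hfg.exists_polynomial
  have hPd : P.natDegree ≤ p :=
    Polynomial.natDegree_le_iff_degree_le.2 (Order.lt_succ_iff.1 (by exact_mod_cast hP))
  have hmem := mem_splineSpace_of_polynomial ((p : ℤ) - 1) n hPd hfP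
  have h := norm_sub_starProjection_iterate_le volterra norm_one_eq inner_volterra_add
    (fun q => splineSpace q ((q : ℤ) - 1) n) (fun q => one_mem_splineSpace _ _ _)
    (fun q s hs => volterra_mem_splineSpace q n hs) (C := 1 / (3 * n)) (by positivity)
    (norm_volterra_sub_starProjection_le n) p g
  refine le_trans (le_of_eq ?_) h
  have hproj := (Submodule.starProjection_eq_self_iff (K := splineSpace p ((p : ℤ) - 1) n)).2 hmem
  rw [map_sub] at hproj
  unfold splineProj
  congr 1
  exact sub_eq_sub_iff_sub_eq_sub.2 hproj.symm

theorem admissibleConstants_mono {p : ℕ} {k l : ℤ} (hkl : k ≤ l) (n : ℕ+) (q : ℕ) :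
    admissibleConstants p l n q ⊆ admissibleConstants p k n q := fun _ hC f hf g hg =>
  (norm_sub_starProjection_le _ _ (splineSpace_anti_smoothness p hkl n
    ((splineSpace p l n).starProjection_apply_mem f))).trans (hC f hf g hg)

/-- The polynomial `P` as an element of `L²(0,1)`. -/
def polyL2 (P : ℝ[X]) : L2 := (memLp_of_continuousOn P.continuous.continuousOn).toLp _

theorem coeFn_polyL2 (P : ℝ[X]) :
    polyL2 P =ᵐ[volume.restrict (Ioo (0 : ℝ) 1)] fun x => P.eval x :=
  MemLp.coeFn_toLp (memLp_of_continuousOn P.continuous.continuousOn)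

open Polynomial in
theorem hasWeakDeriv_polyL2 (P : ℝ[X]) (j : ℕ) :
    HasWeakDeriv j (polyL2 P) (polyL2 (derivative^[j] P)) := by
  intro φ h1 h2 h3
  rw [setIntegral_Ioo_eq, setIntegral_Ioo_eq,
    integral_congr_mul (coeFn_polyL2 _) (Filter.EventuallyEq.refl _ _),
    integral_congr_mul (coeFn_polyL2 _) (Filter.EventuallyEq.refl _ _)]
  exact IsTest.integral_eval_mul_iteratedDeriv ⟨h1, h2, h3⟩ P j

open Polynomial in
/-- The lower bound, valid for every smoothness: it comes from comparing
`x ^ (p + 1) / (p + 1)!` with an arbitrary polynomial of degree at most `p` on each segment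
separately. -/
theorem legendreConst_le_of_mem {p : ℕ} {k : ℤ} {n : ℕ+} {C : ℝ}
    (hC : C ∈ admissibleConstants p k n p) :
    0 ≤ C ∧ (1 / (n : ℝ)) ^ (2 * (p + 1)) * legendreConst (p + 1) ≤ C ^ 2 := by
  have hn : (0 : ℝ) < (n : ℝ) := by exact_mod_cast n.pos
  set N := p + 1 with hN
  have hN0 : (N.factorial : ℝ) ≠ 0 := by exact_mod_cast Nat.factorial_ne_zero N
  set Q : ℝ[X] := Polynomial.C (1 / (N.factorial : ℝ)) * X ^ N with hQ
  have hQd : derivative^[N] Q = 1 := by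
    rw [hQ, iterate_derivative_C_mul, iterate_derivative_X_pow_eq_C_mul, Nat.descFactorial_self,
      Nat.sub_self, pow_zero, mul_one, ← C_mul, one_div_mul_cancel hN0, C_1]
  have hg : ‖polyL2 (derivative^[N] Q)‖ = 1 := by
    have h := norm_sq_eq_integral _ (coeFn_polyL2 (derivative^[N] Q))
    rw [hQd] at h ⊢
    simp only [eval_one, one_pow, intervalIntegral.integral_const, sub_zero, smul_eq_mul,
      mul_one] at h
    exact (pow_eq_one_iff_of_nonneg (norm_nonneg _) two_ne_zero).1 h
  have h := hC (polyL2 Q) (fun j _ => ⟨_, hasWeakDeriv_polyL2 Q j⟩) _ (hasWeakDeriv_polyL2 Q N)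
  rw [hg, mul_one] at h
  refine ⟨(norm_nonneg _).trans h, le_trans ?_ (pow_le_pow_left₀ (norm_nonneg _) h 2)⟩
  obtain ⟨s, ⟨-, hs⟩, hs'⟩ := (splineSpace p k n).starProjection_apply_mem (polyL2 Q)
  choose P hP hPs using hs
  rw [norm_sq_eq_sum_segment n _ (fun j x => (Q - P j).eval x)]
  · have hj : ∀ j : Fin n, (1 / (n : ℝ)) ^ (2 * N + 1) * legendreConst N ≤
        ∫ x in ((j : ℝ) / n)..(((j : ℝ) + 1) / n), (Q - P j).eval x ^ 2 := by
      intro j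
      obtain ⟨-, -, hab, hL⟩ := segment_bounds n j
      have hdeg : (Q - P j).natDegree ≤ N :=
        (natDegree_sub_le_of_le (natDegree_C_mul_X_pow_le _ _)
          ((hP j).trans (Nat.le_succ p))).trans_eq (max_self _)
      have h1 := le_integral_eval_sq_of_interval hdeg hab
      have h2 : (Q - P j).coeff N = 1 / N.factorial := by
        rw [coeff_sub, coeff_eq_zero_of_natDegree_lt (Nat.lt_succ_of_le (hP j)), hQ]
        simp
      rw [hL, h2, mul_one_div_cancel hN0, one_pow, mul_one] at h1
      exact h1
    refine le_trans (le_of_eq ?_) (Finset.sum_le_sum fun j _ => hj j)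
    rw [Finset.sum_const, Finset.card_univ, Fintype.card_fin, nsmul_eq_mul, pow_succ]
    field_simp
  · filter_upwards [Lp.coeFn_sub (polyL2 Q) (splineProj p k n (polyL2 Q)), hs',
      coeFn_polyL2 Q] with x h1 h2 h3 j hj
    rw [h1, Pi.sub_apply, h3, eval_sub, ← hPs j x hj, ← h2]
    rfl

theorem isLeast_splineConst {p : ℕ} {k : ℤ} (hk : k ≤ (p : ℤ) - 1) (n : ℕ+) :
    IsLeast (admissibleConstants p k n p) (splineConst p k n) := by
  have hne : (admissibleConstants p k n p).Nonempty :=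
    ⟨_, admissibleConstants_mono hk n p (pow_mem_admissibleConstants p n)⟩
  have hbdd : BddBelow (admissibleConstants p k n p) :=
    ⟨0, fun _ hC => (legendreConst_le_of_mem hC).1⟩
  refine ⟨fun f hf g hg => ?_, fun C hC => csInf_le hbdd hC⟩
  rcases (norm_nonneg g).eq_or_lt with h0 | h0
  · obtain ⟨C, hC⟩ := hne
    have := hC f hf g hg
    rw [← h0, mul_zero] at this ⊢
    exact this
  · -- For fixed `f` and `g` the condition on `C` is a lower bound, which the infimum inherits.
    rw [← div_le_iff₀ h0]
    exact le_csInf hne fun C hC => (div_le_iff₀ h0).2 (hC f hf g hg)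

end SplineApprox
end

theorem mainTheorem2 (k : ℤ) (hk : -1 ≤ k) (n : ℕ+) (hn : 2 ≤ n) :
    ∃ pbar : ℕ, k < (pbar : ℤ) ∧ ∀ p : ℕ, pbar ≤ p → ∀ m : ℕ+,
      (m : ℤ) = ((n : ℤ) - 1) * ((p : ℤ) - k) + 1 →
        IsLeast (SplineApprox.admissibleConstants p ((p : ℤ) - 1) m p)
          (SplineApprox.splineConst p ((p : ℤ) - 1) m) ∧
        IsLeast (SplineApprox.admissibleConstants p k n p) (SplineApprox.splineConst p k n) ∧
        SplineApprox.splineConst p ((p : ℤ) - 1) m < SplineApprox.splineConst p k n := by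
  obtain ⟨d, hd⟩ := Int.eq_ofNat_of_zero_le (show 0 ≤ k + 1 by omega)
  obtain ⟨N₀, hN₀⟩ := Filter.eventually_atTop.1 (SplineApprox.eventually_pow_lt_legendreConst d)
  refine ⟨max N₀ (d + 1), ?_, fun p hp m hm => ?_⟩
  · have := le_max_right N₀ (d + 1)
    omega
  have hp1 : N₀ ≤ p := (le_max_left _ _).trans hp
  have hp2 : d + 1 ≤ p := (le_max_right _ _).trans hp
  have hL1 := SplineApprox.isLeast_splineConst (le_refl ((p : ℤ) - 1)) m
  have hL2 := SplineApprox.isLeast_splineConst (show k ≤ (p : ℤ) - 1 by omega) n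
  refine ⟨hL1, hL2, ?_⟩
  obtain ⟨hC0, hC⟩ := SplineApprox.legendreConst_le_of_mem hL2.1
  refine (hL1.2 (SplineApprox.pow_mem_admissibleConstants p m)).trans_lt ?_
  refine lt_of_pow_lt_pow_left₀ 2 hC0 (lt_of_lt_of_le ?_ hC)
  have hlt := hN₀ (p + 1) (by omega)
  have hn2 : (2 : ℝ) ≤ n := by exact_mod_cast hn
  have hdp : (d : ℝ) + 1 ≤ p := by exact_mod_cast hp2
  have hM : (0 : ℝ) < ((p + 1 : ℕ) : ℝ) - d := by push_cast; linarith
  have hm' : (m : ℝ) = ((n : ℝ) - 1) * (((p + 1 : ℕ) : ℝ) - d) + 1 := by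
    have hk' : k = (d : ℤ) - 1 := by omega
    rw [hk'] at hm
    have : (m : ℝ) = ((n : ℝ) - 1) * ((p : ℝ) - ((d : ℝ) - 1)) + 1 := by exact_mod_cast hm
    rw [this]; push_cast; ring
  have hm0 : (0 : ℝ) < m := by exact_mod_cast m.pos
  -- The ratio `n / (n - 1)` is largest for `n = 2`, where it equals `2`.
  have hratio : 1 / (3 * (m : ℝ)) ≤ 1 / n * (2 / (3 * (((p + 1 : ℕ) : ℝ) - d))) := by
    rw [div_mul_div_comm, one_mul, div_le_div_iff₀ (by positivity) (by positivity), hm']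
    nlinarith [mul_nonneg (sub_nonneg.2 hn2) hM.le]
  calc ((1 / (3 * (m : ℝ))) ^ (p + 1)) ^ 2 = (1 / (3 * (m : ℝ))) ^ (2 * (p + 1)) := by
        rw [← pow_mul, mul_comm 2]
    _ ≤ (1 / n * (2 / (3 * (((p + 1 : ℕ) : ℝ) - d)))) ^ (2 * (p + 1)) := by gcongr
    _ = (1 / (n : ℝ)) ^ (2 * (p + 1)) * (2 / (3 * (((p + 1 : ℕ) : ℝ) - d))) ^ (2 * (p + 1)) :=
        mul_pow _ _ _
    _ < _ := by gcongr
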